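/- Let $\mathbb F$ be any field. A symplectic alternating algebra (SAA) over $\mathbb F$ is an $\mathbb F$-vector space $L$ with a non-degenerate alternating bilinear form $(\cdot,\cdot)$ and a bilinear alternating product (so $x\cdot x=0$) such that $(x\cdot y,z)=(y\cdot z,x)$ for all $x,y,z\in L$. Put $L^{1}=L$, $L^{n+1}=L^{n}\cdot L$ (the span of the products $u\cdot v$ with $u\in L^n$, $v\in L$), call $L$ nilpotent if $L^{n}=0$ for some $n\ge 1$, and let $Z(L)=\{z\in L: z\cdot u=0 \text{ for all } u\in L\}$. If $L^{3}=Z(L)$, then for $\bar z=z+Z(L)\in L^{2}/Z(L)$ there is a well-defined alternating form $\phi_{\bar z}$ on $L/L^{2}$ given by $\phi_{\bar z}(u+L^2,v+L^2)=(z\cdot u,v)$. We say that $L$ is of type C if it is a nilpotent SAA of dimension $10$ whose centre is isotropic of dimension $4$, $L^{3}=Z(L)$, and $\phi_{\bar z}$ is non-degenerate for every $0\ne\bar z\in L^{2}/Z(L)$. A standard basis of a $10$-dimensional SAA is a basis $x_1,y_1,\dots,x_5,y_5$ with $(x_i,x_j)=(y_i,y_j)=0$ and $(x_i,y_j)=\delta_{ij}$.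 For $\alpha,\beta\in\mathbb F$, we say that $L$ has the presentation $$\mathcal P_{10}^{(4,4)}(\alpha,\beta):\ (x_{1}y_{2},y_{3})=1,\ (x_{1}y_{3},y_{4})=\alpha,\ (x_{1}y_{4},y_{5})=\beta,\ (y_{1}y_{2},y_{5})=1,\ (y_{1}y_{3},y_{4})=1$$ if for some standard basis these equalities hold and all triple values $(uv,w)$ of basis vectors that are not determined by them through the alternating symmetry of $(u,v,w)\mapsto (uv,w)$ are $0$. 1. Every SAA of type C has a presentation $\mathcal P_{10}^{(4,4)}(\alpha,\beta)$ for some $\alpha,\beta\in\mathbb F$ such that $t^{2}+\alpha t+\beta$ is irreducible in $\mathbb F[t]$. 2. Conversely, if $t^{2}+\alpha t+\beta$ is irreducible in $\mathbb F[t]$, then there is an SAA with the presentation $\mathcal P_{10}^{(4,4)}(\alpha,\beta)$, and every SAA with this presentation is of type C. 3. Let $t^{2}+\alpha t+\beta$ and $t^{2}+\tilde\alpha t+\tilde\beta$ be irreducible in $\mathbb F[t]$. Then $\mathcal P_{10}^{(4,4)}(\alpha,\beta)$ and $\mathcal P_{10}^{(4,4)}(\tilde\alpha,\tilde\beta)$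 describe the same algebra (that is, an SAA with the first presentation and an SAA with the second are isomorphic through a linear bijection preserving both the form and the product) if and only if $$\tilde\alpha=\frac{(ad+bc)\alpha+2ac\beta+2bd}{d^{2}+\alpha cd+c^{2}\beta},\qquad \tilde\beta=\frac{b^{2}+ab\alpha+a^{2}\beta}{d^{2}+cd\alpha+c^{2}\beta}$$ for some $a,b,c,d\in\mathbb F$ with $ad-bc=1$. -/

import Mathlib

/-- A symplectic alternating algebra over `F` on the vector space `L`: a non-degenerate alternating
form together with a bilinear alternating product such that `(x · y, z) = (y · z, x)`. -/
structure SAA (F L : Type*) [Field F] [AddCommGroup L] [Module F L] where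
  /-- the symplectic form `(u, v)` -/
  form : LinearMap.BilinForm F L
  form_alt : ∀ u : L, form u u = 0
  form_nondegenerate : form.Nondegenerate
  /-- the product `u · v` -/
  mul : L →ₗ[F] L →ₗ[F] L
  mul_alt : ∀ u : L, mul u u = 0
  cyclic : ∀ u v w : L, form (mul u v) w = form (mul v w) u

namespace SAA

section Basic

variable {F L : Type*} [Field F] [AddCommGroup L] [Module F L]

/-- The lower central series with its usual numbering: `L¹ = L` and `Lⁿ⁺¹ = Lⁿ · L`, the span of
all products `u · v` with `u ∈ Lⁿ` and `v ∈ L`. (The value at `0` is not used.) -/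
def power (S : SAA F L) : ℕ → Submodule F L
  | 0 => ⊤
  | 1 => ⊤
  | n + 2 => Submodule.map₂ S.mul (S.power (n + 1)) ⊤

/-- The algebra is nilpotent: some term of the lower central series vanishes. -/
def IsNilpotent (S : SAA F L) : Prop := ∃ n : ℕ, S.power n.succ = ⊥

/-- The centre `Z(L) = {z | z · u = 0 for all u}`. -/
def center (S : SAA F L) : Submodule F L := LinearMap.ker S.mul

/-- A subspace is isotropic if the symplectic form vanishes on it. -/
def IsIsotropic (S : SAA F L) (U : Submodule F L) : Prop :=
  ∀ u ∈ U, ∀ v ∈ U, S.form u v = 0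

theorem form_skew (S : SAA F L) (u v : L) : S.form u v = -S.form v u := by
  have h := S.form_alt (u + v)
  simp only [map_add, LinearMap.add_apply, S.form_alt, zero_add, add_zero] at h
  rw [add_comm] at h
  exact eq_neg_of_add_eq_zero_left h

theorem mul_skew (S : SAA F L) (u v : L) : S.mul u v = -S.mul v u := by
  have h := S.mul_alt (u + v)
  simp only [map_add, LinearMap.add_apply, S.mul_alt, zero_add, add_zero] at h
  rw [add_comm] at h
  exact eq_neg_of_add_eq_zero_left h

theorem form_power_two_center (S : SAA F L) {w c : L} (hw : w ∈ S.power 2)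
    (hc : c ∈ S.center) : S.form w c = 0 := by
  have h : S.power 2 ≤ LinearMap.ker (S.form.flip c) := by
    refine Submodule.map₂_le.2 fun a _ b _ => ?_
    have hc' : S.mul c = 0 := hc
    rw [LinearMap.mem_ker]
    change S.form (S.mul a b) c = 0
    rw [S.cyclic, S.mul_skew, hc']
    simp
  exact h hw

theorem mul_mem_power_three (S : SAA F L) {w : L} (hw : w ∈ S.power 2) (v : L) :
    S.mul w v ∈ S.power 3 :=
  Submodule.apply_mem_map₂ _ hw Submodule.mem_top

/-- If `L³ = Z(L)`, then `L²` is abelian. -/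
theorem mul_eq_zero_of_mem_power_two (S : SAA F L) (h : S.power 3 = S.center) {z w : L}
    (hz : z ∈ S.power 2) (hw : w ∈ S.power 2) : S.mul z w = 0 := by
  refine S.form_nondegenerate.1 _ fun v => ?_
  rw [S.cyclic, S.form_skew, S.form_power_two_center hz (h ▸ S.mul_mem_power_three hw v), neg_zero]

/-- For `z ∈ L²`, the form `(ū, v̄) ↦ (z · u, v)` on `L / L²`; it is well defined when
`L³ = Z(L)`. -/
def phiAux (S : SAA F L) (h : S.power 3 = S.center) (z : S.power 2) :
    LinearMap.BilinForm F (L ⧸ S.power 2) :=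
  LinearMap.liftQ₂ (S.power 2) (S.power 2) (LinearMap.comp S.form (S.mul z))
    (fun u hu => by
      rw [LinearMap.mem_ker, LinearMap.comp_apply, S.mul_eq_zero_of_mem_power_two h z.2 hu,
        map_zero])
    (fun v hv => by
      ext u
      simp only [LinearMap.flip_apply, LinearMap.comp_apply, LinearMap.zero_apply]
      rw [S.form_skew,
        S.form_power_two_center hv (h ▸ S.mul_mem_power_three z.2 u), neg_zero])

theorem phiAux_mk (S : SAA F L) (h : S.power 3 = S.center) (z : S.power 2) (u v : L) :
    S.phiAux h z (Submodule.Quotient.mk u) (Submodule.Quotient.mk v) =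
      S.form (S.mul z u) v := rfl

/-- The family of forms `φ_z̄ : L / L² × L / L² → F`, `φ_z̄ (ū, v̄) = (z · u, v)`, indexed
(linearly) by `z̄ ∈ L² / Z(L)`, for an algebra with `L³ = Z(L)`. -/
def phi (S : SAA F L) (h : S.power 3 = S.center) :
    (S.power 2 ⧸ S.center.submoduleOf (S.power 2)) →ₗ[F]
      LinearMap.BilinForm F (L ⧸ S.power 2) :=
  Submodule.liftQ _
    { toFun := S.phiAux h
      map_add' := fun z t => by
        ext u v
        change S.form (S.mul (z + t : L) u) v = S.form (S.mul z u) v + S.form (S.mul t u) v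
        simp
      map_smul' := fun r z => by
        ext u v
        change S.form (S.mul (r • z : L) u) v = r • S.form (S.mul z u) v
        simp }
    (fun z hz => by
      have hz' : S.mul z = 0 := hz
      ext u v
      change S.form (S.mul z u) v = 0
      simp [hz'])

theorem phi_mk (S : SAA F L) (h : S.power 3 = S.center) (z : S.power 2) (u v : L) :
    S.phi h (Submodule.Quotient.mk z) (Submodule.Quotient.mk u) (Submodule.Quotient.mk v) =
      S.form (S.mul z u) v := rfl

/-- Nilpotent symplectic alternating algebras of dimension `10` with isotropic centre of
dimension `4` and `L³ = Z(L)` that are of type C: the form `φ_z̄` is non-degenerate for every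
non-zero `z̄ ∈ L² / Z(L)`. -/
structure IsTypeC (S : SAA F L) : Prop where
  finrank_eq : Module.finrank F L = 10
  nilpotent : S.IsNilpotent
  center_isotropic : S.IsIsotropic S.center
  finrank_center : Module.finrank F S.center = 4
  power_three_eq : S.power 3 = S.center
  phi_nondegenerate : ∀ z : S.power 2 ⧸ S.center.submoduleOf (S.power 2), z ≠ 0 →
    (S.phi power_three_eq z).Nondegenerate

/-- A standard basis `x₁, y₁, …, xₙ, yₙ` of `L`: `(xᵢ, xⱼ) = (yᵢ, yⱼ) = 0` and
`(xᵢ, yⱼ) = δᵢⱼ`. Indices are shifted: `x i` is the vector usually called `xᵢ₊₁`. -/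
structure StandardBasis (S : SAA F L) (n : ℕ) where
  basis : Module.Basis (Fin n ⊕ Fin n) F L
  form_x_x : ∀ i j : Fin n, S.form (basis (Sum.inl i)) (basis (Sum.inl j)) = 0
  form_y_y : ∀ i j : Fin n, S.form (basis (Sum.inr i)) (basis (Sum.inr j)) = 0
  form_x_y : ∀ i j : Fin n,
    S.form (basis (Sum.inl i)) (basis (Sum.inr j)) = if i = j then 1 else 0

/-- The vector `xᵢ₊₁` of a standard basis. -/
noncomputable def StandardBasis.x {S : SAA F L} {n : ℕ} (b : S.StandardBasis n) (i : Fin n) : L :=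
  b.basis (Sum.inl i)

/-- The vector `yᵢ₊₁` of a standard basis. -/
noncomputable def StandardBasis.y {S : SAA F L} {n : ℕ} (b : S.StandardBasis n) (i : Fin n) : L :=
  b.basis (Sum.inr i)

/-- `S` has, with respect to the standard basis `b`, the nilpotent presentation
`(xᵢ yⱼ, yₖ) = A i j k`, `(yᵢ yⱼ, yₖ) = B i j k` for `i < j < k`; as usual, all triple values
of basis vectors that these do not determine by the alternating symmetry are zero. Only the
entries of `A` and `B` with `i < j < k` are used. -/
structure StandardBasis.HasPresentation {S : SAA F L} {n : ℕ} (b : S.StandardBasis n)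
    (A B : Fin n → Fin n → Fin n → F) : Prop where
  xxx : ∀ i j k : Fin n, S.form (S.mul (b.x i) (b.x j)) (b.x k) = 0
  xxy : ∀ i j k : Fin n, S.form (S.mul (b.x i) (b.x j)) (b.y k) = 0
  xyy : ∀ i j k : Fin n, i < j → j < k → S.form (S.mul (b.x i) (b.y j)) (b.y k) = A i j k
  xyy_zero : ∀ i j k : Fin n, j ≤ i → S.form (S.mul (b.x i) (b.y j)) (b.y k) = 0
  yyy : ∀ i j k : Fin n, i < j → j < k → S.form (S.mul (b.y i) (b.y j)) (b.y k) = B i j k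

/-- The values `(xᵢ yⱼ, yₖ)` of the presentation `P(α, β)`: `(x₁ y₂, y₃) = 1`,
`(x₁ y₃, y₄) = α`, `(x₁ y₄, y₅) = β` (indices shifted by one). -/
def coeffX (α β : F) : Fin 5 → Fin 5 → Fin 5 → F
  | 0, 1, 2 => 1
  | 0, 2, 3 => α
  | 0, 3, 4 => β
  | _, _, _ => 0

variable (F) in
/-- The values `(yᵢ yⱼ, yₖ)` of the presentation `P(α, β)`: `(y₁ y₂, y₅) = 1`,
`(y₁ y₃, y₄) = 1` (indices shifted by one). -/
def coeffY : Fin 5 → Fin 5 → Fin 5 → F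
  | 0, 1, 4 => 1
  | 0, 2, 3 => 1
  | _, _, _ => 0

/-- The standard basis `b` gives the presentation `P(α, β)`. -/
def StandardBasis.HasP {S : SAA F L} (b : S.StandardBasis 5) (α β : F) : Prop :=
  b.HasPresentation (coeffX α β) (coeffY F)

/-- The algebra `S` has the presentation `P(α, β)` with respect to some standard basis. -/
def HasP (S : SAA F L) (α β : F) : Prop := ∃ b : S.StandardBasis 5, b.HasP α β

end Basic

/-- An isomorphism of symplectic alternating algebras: a linear bijection that preserves the
symplectic form and the product. -/
structure Iso {F L L' : Type*} [Field F] [AddCommGroup L] [Module F L] [AddCommGroup L']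
    [Module F L'] (S : SAA F L) (S' : SAA F L') where
  toEquiv : L ≃ₗ[F] L'
  map_form : ∀ u v : L, S'.form (toEquiv u) (toEquiv v) = S.form u v
  map_mul : ∀ u v : L, toEquiv (S.mul u v) = S'.mul (toEquiv u) (toEquiv v)

end SAA

/-! Non-degeneracy makes `Z(L)` the orthogonal complement of `L²`. For type C this gives `dim L² =
6`, and `L² / Z(L)` is a symplectic plane. The map `z̄ ↦ φ_z̄` is then a pencil of alternating forms
on the 4-dimensional space `L / L²`, and the whole classification lies in the Pfaffian of this
pencil. In a presentation `P(α, β)` the Pfaffian at `r x₁ + s y₁` is `s² + α r s + β r²`; it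
vanishes only at the origin exactly when `t² + α t + β` has no root, that is, when this quadratic is
irreducible.

Existence: any `z₁, z₂ ∈ L²` with `(z₁, z₂) = 1` can serve, modulo the centre, as `x₁, y₁`.
`exists_pencil_frame` normalises the pencil, the products of `z₂` with the frame give the dual
central vectors, and translations by `z₂` and by the centre remove the remaining triple values and
make the basis standard (`IsTypeC.exists_hasP`). A root of the quadratic would produce a degenerate
`φ_z̄` (`HasP.no_root`).

Isomorphism: two presentations of one algebra differ on `L² / Z(L)` by a matrix of determinant 1. A
change of frame in `L / L²` multiplies the Pfaffian by a constant, which is fixed by the coefficient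
of `s²` being 1; this yields the formulas (`HasP.parameters_eq`). Conversely every such matrix
occurs, since the pair `z₁, z₂` was arbitrary. -/

namespace SAA

/-! ### Alternating symmetry of the triple product -/

section Triple

variable {F L : Type*} [Field F] [AddCommGroup L] [Module F L]

theorem form_mul_swap (S : SAA F L) (u v w : L) :
    S.form (S.mul u v) w = -S.form (S.mul v u) w := by
  rw [S.mul_skew]; simp

theorem form_mul_swap_right (S : SAA F L) (u v w : L) :
    S.form (S.mul u v) w = -S.form (S.mul u w) v := by
  rw [S.cyclic u v w, S.cyclic u w v, S.form_mul_swap]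

theorem form_mul_self_right (S : SAA F L) (u v : L) : S.form (S.mul u v) v = 0 := by
  rw [S.cyclic, S.mul_alt]; simp

theorem form_mul_self_left (S : SAA F L) (u v : L) : S.form (S.mul u u) v = 0 := by
  rw [S.mul_alt]; simp

theorem form_mul_self_outer (S : SAA F L) (u v : L) : S.form (S.mul u v) u = 0 := by
  rw [S.form_mul_swap, S.form_mul_self_right, neg_zero]

theorem eq_of_form_eq (S : SAA F L) {u v : L} (h : ∀ w, S.form u w = S.form v w) : u = v := by
  rw [← sub_eq_zero]
  refine S.form_nondegenerate.1 _ fun w => ?_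
  simp [h w]

/-- An isomorphism given by a bijection of bases along which the forms and the triple values
agree. -/
noncomputable def isoOfBasis {L' ι : Type*} [AddCommGroup L'] [Module F L'] {S : SAA F L}
    {S' : SAA F L'} (b : Module.Basis ι F L) (b' : Module.Basis ι F L')
    (hform : ∀ p q, S.form (b p) (b q) = S'.form (b' p) (b' q))
    (hmul : ∀ p q r,
      S.form (S.mul (b p) (b q)) (b r) = S'.form (S'.mul (b' p) (b' q)) (b' r)) :
    S.Iso S' :=
  have hf : ∀ u v, S'.form (b.equiv b' (Equiv.refl ι) u) (b.equiv b' (Equiv.refl ι) v) =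
      S.form u v := by
    have : S'.form.compl₁₂ (b.equiv b' (Equiv.refl ι)).toLinearMap
        (b.equiv b' (Equiv.refl ι)).toLinearMap = S.form :=
      LinearMap.ext_basis b b fun p q => by simp [hform]
    intro u v
    exact congrArg (fun B => B u v) this
  { toEquiv := b.equiv b' (Equiv.refl ι)
    map_form := hf
    map_mul := by
      have : S.mul.compr₂ (b.equiv b' (Equiv.refl ι)).toLinearMap =
          S'.mul.compl₁₂ (b.equiv b' (Equiv.refl ι)).toLinearMap
            (b.equiv b' (Equiv.refl ι)).toLinearMap := by
        -- By non-degeneracy a product is known once its pairings with a basis are, and those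
        -- pairings are the triple values.
        refine LinearMap.ext_basis b b fun p q => S'.eq_of_form_eq fun w => ?_
        suffices h : S'.form (b.equiv b' (Equiv.refl ι) (S.mul (b p) (b q))) =
            S'.form (S'.mul (b' p) (b' q)) by
          simpa using congrArg (fun B => B w) h
        refine b'.ext fun r => ?_
        have hr : b' r = b.equiv b' (Equiv.refl ι) (b r) := by simp
        conv_lhs => rw [hr, hf]
        exact hmul p q r
      intro u v
      exact congrArg (fun B => B u v) this }

theorem Iso.map_triple {L' : Type*} [AddCommGroup L'] [Module F L'] {S : SAA F L}
    {S' : SAA F L'} (e : S.Iso S') (u v w : L) :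
    S'.form (S'.mul (e.toEquiv u) (e.toEquiv v)) (e.toEquiv w) = S.form (S.mul u v) w := by
  rw [← e.map_mul, e.map_form]

end Triple

/-! ### A presentation determines the algebra -/

namespace StandardBasis

variable {F L : Type*} [Field F] [AddCommGroup L] [Module F L]

section Uniqueness

variable {L' : Type*} [AddCommGroup L'] [Module F L'] {S : SAA F L} {S' : SAA F L'} {n : ℕ}
  {b : S.StandardBasis n} {b' : S'.StandardBasis n} {A B : Fin n → Fin n → Fin n → F}

theorem form_y_x (b : S.StandardBasis n) (i j : Fin n) :
    S.form (b.basis (Sum.inr i)) (b.basis (Sum.inl j)) = -if j = i then 1 else 0 := by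
  rw [S.form_skew, b.form_x_y]

theorem form_basis_eq (b : S.StandardBasis n) (b' : S'.StandardBasis n) (p q : Fin n ⊕ Fin n) :
    S.form (b.basis p) (b.basis q) = S'.form (b'.basis p) (b'.basis q) := by
  rcases p with i | i <;> rcases q with j | j <;>
    simp [form_x_x, form_y_y, form_x_y, form_y_x]

theorem HasPresentation.xyy_eq (h : b.HasPresentation A B) (h' : b'.HasPresentation A B)
    (i j k : Fin n) :
    S.form (S.mul (b.x i) (b.y j)) (b.y k) = S'.form (S'.mul (b'.x i) (b'.y j)) (b'.y k) := by
  have key : ∀ j k, j < k →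
      S.form (S.mul (b.x i) (b.y j)) (b.y k) =
        S'.form (S'.mul (b'.x i) (b'.y j)) (b'.y k) := fun j k hjk => by
    rcases le_or_gt j i with hji | hij
    · rw [h.xyy_zero i j k hji, h'.xyy_zero i j k hji]
    · rw [h.xyy i j k hij hjk, h'.xyy i j k hij hjk]
  rcases lt_trichotomy j k with hjk | rfl | hkj
  · exact key j k hjk
  · rw [form_mul_self_right, form_mul_self_right]
  · rw [form_mul_swap_right, key k j hkj, ← form_mul_swap_right]

theorem HasPresentation.yyy_eq (h : b.HasPresentation A B) (h' : b'.HasPresentation A B)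
    (i j k : Fin n) :
    S.form (S.mul (b.y i) (b.y j)) (b.y k) = S'.form (S'.mul (b'.y i) (b'.y j)) (b'.y k) := by
  have key : ∀ i j k, i < j →
      S.form (S.mul (b.y i) (b.y j)) (b.y k) =
        S'.form (S'.mul (b'.y i) (b'.y j)) (b'.y k) := fun i j k hij => by
    rcases lt_trichotomy j k with hjk | rfl | hkj
    · rw [h.yyy i j k hij hjk, h'.yyy i j k hij hjk]
    · rw [form_mul_self_right, form_mul_self_right]
    rcases lt_trichotomy i k with hik | rfl | hki
    · rw [form_mul_swap_right, h.yyy i k j hik hkj, form_mul_swap_right, h'.yyy i k j hik hkj]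
    · rw [form_mul_self_outer, form_mul_self_outer]
    · rw [← S.cyclic, ← S'.cyclic, h.yyy k i j hki hij, h'.yyy k i j hki hij]
  rcases lt_trichotomy i j with hij | rfl | hji
  · exact key i j k hij
  · rw [form_mul_self_left, form_mul_self_left]
  · rw [form_mul_swap, key j i k hji, ← form_mul_swap]

/-- Alternating symmetry moves the `x`'s to the front, leaving only the types xxx, xxy, xyy and yyy
that the presentation prescribes. -/
theorem HasPresentation.triple_eq (h : b.HasPresentation A B) (h' : b'.HasPresentation A B)
    (p q r : Fin n ⊕ Fin n) :
    S.form (S.mul (b.basis p) (b.basis q)) (b.basis r) =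
      S'.form (S'.mul (b'.basis p) (b'.basis q)) (b'.basis r) := by
  rcases p with i | i <;> rcases q with j | j <;> rcases r with k | k
  · exact (h.xxx i j k).trans (h'.xxx i j k).symm
  · exact (h.xxy i j k).trans (h'.xxy i j k).symm
  · rw [form_mul_swap_right, form_mul_swap_right S']
    exact congrArg Neg.neg ((h.xxy i k j).trans (h'.xxy i k j).symm)
  · exact h.xyy_eq h' i j k
  · rw [S.cyclic, S'.cyclic]
    exact (h.xxy j k i).trans (h'.xxy j k i).symm
  · rw [form_mul_swap, form_mul_swap S']
    exact congrArg Neg.neg (h.xyy_eq h' j i k)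
  · rw [← S.cyclic, ← S'.cyclic]
    exact h.xyy_eq h' k i j
  · exact h.yyy_eq h' i j k

/-- Two algebras with the same presentation are isomorphic. -/
noncomputable def HasPresentation.iso (h : b.HasPresentation A B)
    (h' : b'.HasPresentation A B) : S.Iso S' :=
  isoOfBasis b.basis b'.basis (form_basis_eq b b') (h.triple_eq h')

/-- The image of a standard basis under an isomorphism. -/
noncomputable def map (b : S.StandardBasis n) (e : S.Iso S') : S'.StandardBasis n where
  basis := b.basis.map e.toEquiv
  form_x_x i j := by simp [e.map_form, b.form_x_x]
  form_y_y i j := by simp [e.map_form, b.form_y_y]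
  form_x_y i j := by simp [e.map_form, b.form_x_y]

theorem map_x (b : S.StandardBasis n) (e : S.Iso S') (i : Fin n) :
    (b.map e).x i = e.toEquiv (b.x i) := by simp [map, x]

theorem map_y (b : S.StandardBasis n) (e : S.Iso S') (i : Fin n) :
    (b.map e).y i = e.toEquiv (b.y i) := by simp [map, y]

theorem HasPresentation.map (h : b.HasPresentation A B) (e : S.Iso S') :
    (b.map e).HasPresentation A B where
  xxx i j k := by simp only [map_x, e.map_triple, h.xxx]
  xxy i j k := by simp only [map_x, map_y, e.map_triple, h.xxy]
  xyy i j k hij hjk := by simp only [map_x, map_y, e.map_triple, h.xyy i j k hij hjk]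
  xyy_zero i j k hji := by simp only [map_x, map_y, e.map_triple, h.xyy_zero i j k hji]
  yyy i j k hij hjk := by simp only [map_y, e.map_triple, h.yyy i j k hij hjk]

theorem repr_inl (b : S.StandardBasis n) (u : L) (i : Fin n) :
    b.basis.repr u (Sum.inl i) = S.form u (b.y i) := by
  have : b.basis.coord (Sum.inl i) = S.form.flip (b.y i) :=
    b.basis.ext fun p => by
      rcases p with j | j
      · simp [y, form_x_y, Finsupp.single_apply]
      · simp [y, form_y_y]
  exact congrArg (fun f => f u) this

theorem repr_inr (b : S.StandardBasis n) (u : L) (i : Fin n) :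
    b.basis.repr u (Sum.inr i) = S.form (b.x i) u := by
  have : b.basis.coord (Sum.inr i) = S.form (b.x i) :=
    b.basis.ext fun p => by
      rcases p with j | j
      · simp [x, form_x_x]
      · simp [x, form_x_y, Finsupp.single_apply, eq_comm]
  exact congrArg (fun f => f u) this

end Uniqueness

end StandardBasis

/-! ### The coordinate model of `P(α, β)` -/

section Model

variable {F : Type*} [Field F]

/-- The minor `u_p v_q - u_q v_p`. -/
def minor {ι : Type*} (p q : ι) (u v : ι → F) : F := u p * v q - u q * v p

/-- The product of the algebra with presentation `P(α, β)` in coordinates. -/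
def modelProduct (α β : F) (u v : Fin 5 ⊕ Fin 5 → F) : Fin 5 ⊕ Fin 5 → F :=
  Sum.elim
    ![minor (.inr 1) (.inr 4) u v + minor (.inr 2) (.inr 3) u v,
      minor (.inr 2) (.inl 0) u v + minor (.inr 4) (.inr 0) u v,
      minor (.inl 0) (.inr 1) u v + α * minor (.inr 3) (.inl 0) u v + minor (.inr 3) (.inr 0) u v,
      α * minor (.inl 0) (.inr 2) u v + β * minor (.inr 4) (.inl 0) u v +
        minor (.inr 0) (.inr 2) u v,
      β * minor (.inl 0) (.inr 3) u v + minor (.inr 0) (.inr 1) u v]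
    -- The coordinate of `u v` along `y₁` is `(x₁, u v) = -(u v, x₁)`, whence the sign; the
    -- coordinate along `xᵢ` is `(u v, yᵢ)`.
    ![-(minor (.inr 1) (.inr 2) u v + α * minor (.inr 2) (.inr 3) u v +
        β * minor (.inr 3) (.inr 4) u v), 0, 0, 0, 0]

/-- The standard symplectic form on the coordinate space. -/
def modelForm {n : ℕ} : LinearMap.BilinForm F (Fin n ⊕ Fin n → F) :=
  LinearMap.mk₂ F (fun u v => ∑ i, (u (.inl i) * v (.inr i) - u (.inr i) * v (.inl i)))
    (fun u v w => by
      rw [← Finset.sum_add_distrib]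
      exact Finset.sum_congr rfl fun i _ => by simp only [Pi.add_apply]; ring)
    (fun c u v => by
      rw [Finset.smul_sum]
      exact Finset.sum_congr rfl fun i _ => by simp only [Pi.smul_apply, smul_eq_mul]; ring)
    (fun u v w => by
      rw [← Finset.sum_add_distrib]
      exact Finset.sum_congr rfl fun i _ => by simp only [Pi.add_apply]; ring)
    (fun c u v => by
      rw [Finset.smul_sum]
      exact Finset.sum_congr rfl fun i _ => by simp only [Pi.smul_apply, smul_eq_mul]; ring)

theorem modelForm_apply {n : ℕ} (u v : Fin n ⊕ Fin n → F) :
    modelForm u v = ∑ i, (u (.inl i) * v (.inr i) - u (.inr i) * v (.inl i)) := rfl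

theorem modelForm_single_inl {n : ℕ} (u : Fin n ⊕ Fin n → F) (i : Fin n) :
    modelForm u (Pi.single (.inl i) 1) = -u (.inr i) := by
  simp [modelForm_apply, Pi.single_apply]

theorem modelForm_single_inr {n : ℕ} (u : Fin n ⊕ Fin n → F) (i : Fin n) :
    modelForm u (Pi.single (.inr i) 1) = u (.inl i) := by
  simp [modelForm_apply, Pi.single_apply]

theorem modelForm_isAlt {n : ℕ} (u : Fin n ⊕ Fin n → F) : modelForm u u = 0 := by
  rw [modelForm_apply]
  exact Finset.sum_eq_zero fun i _ => by ring

theorem modelForm_nondegenerate {n : ℕ} :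
    (modelForm : LinearMap.BilinForm F (Fin n ⊕ Fin n → F)).Nondegenerate := by
  have hl : ∀ u : Fin n ⊕ Fin n → F, (∀ v, modelForm u v = 0) → u = 0 := fun u hu => by
    ext p
    rcases p with i | i
    · simpa [modelForm_single_inr] using hu (Pi.single (.inr i) 1)
    · simpa [modelForm_single_inl] using hu (Pi.single (.inl i) 1)
  refine ⟨hl, fun v hv => hl v fun u => ?_⟩
  have h := hv u
  rw [modelForm_apply] at h ⊢
  rw [← neg_eq_zero, ← Finset.sum_neg_distrib, ← h]
  exact Finset.sum_congr rfl fun i _ => by ring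

/-- The product of the algebra with presentation `P(α, β)` as a bilinear map. -/
def modelMul (α β : F) :
    (Fin 5 ⊕ Fin 5 → F) →ₗ[F] (Fin 5 ⊕ Fin 5 → F) →ₗ[F] (Fin 5 ⊕ Fin 5 → F) :=
  LinearMap.mk₂ F (modelProduct α β)
    (fun u v w => by
      ext p
      rcases p with i | i <;> fin_cases i <;> simp [modelProduct, minor] <;> ring)
    (fun c u v => by
      ext p
      rcases p with i | i <;> fin_cases i <;> simp [modelProduct, minor] <;> ring)
    (fun u v w => by
      ext p
      rcases p with i | i <;> fin_cases i <;> simp [modelProduct, minor] <;> ring)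
    (fun c u v => by
      ext p
      rcases p with i | i <;> fin_cases i <;> simp [modelProduct, minor] <;> ring)

theorem modelProduct_self (α β : F) (u : Fin 5 ⊕ Fin 5 → F) : modelProduct α β u u = 0 := by
  ext p
  rcases p with i | i <;> fin_cases i <;> simp [modelProduct, minor, mul_comm]

theorem modelForm_modelProduct (α β : F) (u v w : Fin 5 ⊕ Fin 5 → F) :
    modelForm (modelProduct α β u v) w =
      (minor (.inr 1) (.inr 4) u v + minor (.inr 2) (.inr 3) u v) * w (.inr 0) +
      (minor (.inr 2) (.inl 0) u v + minor (.inr 4) (.inr 0) u v) * w (.inr 1) +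
      (minor (.inl 0) (.inr 1) u v + α * minor (.inr 3) (.inl 0) u v +
        minor (.inr 3) (.inr 0) u v) * w (.inr 2) +
      (α * minor (.inl 0) (.inr 2) u v + β * minor (.inr 4) (.inl 0) u v +
        minor (.inr 0) (.inr 2) u v) * w (.inr 3) +
      (β * minor (.inl 0) (.inr 3) u v + minor (.inr 0) (.inr 1) u v) * w (.inr 4) +
      (minor (.inr 1) (.inr 2) u v + α * minor (.inr 2) (.inr 3) u v +
        β * minor (.inr 3) (.inr 4) u v) * w (.inl 0) := by
  simp [modelForm_apply, Fin.sum_univ_five, modelProduct]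
  ring

theorem modelForm_modelProduct_cyclic (α β : F) (u v w : Fin 5 ⊕ Fin 5 → F) :
    modelForm (modelProduct α β u v) w = modelForm (modelProduct α β v w) u := by
  simp only [modelForm_modelProduct, minor]
  ring

/-- The algebra with presentation `P(α, β)` on the coordinate space. -/
def model (α β : F) : SAA F (Fin 5 ⊕ Fin 5 → F) where
  form := modelForm
  form_alt := modelForm_isAlt
  form_nondegenerate := modelForm_nondegenerate
  mul := modelMul α β
  mul_alt := modelProduct_self α β
  cyclic := modelForm_modelProduct_cyclic α β

/-- The coordinate basis of the model. -/
noncomputable def modelBasis (α β : F) : (model α β).StandardBasis 5 where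
  basis := Pi.basisFun F _
  form_x_x i j := by simp [model, modelForm_single_inl]
  form_y_y i j := by simp [model, modelForm_single_inr]
  form_x_y i j := by simp [model, modelForm_single_inr, Pi.single_apply, eq_comm]

theorem model_mul (α β : F) (u v : Fin 5 ⊕ Fin 5 → F) :
    (model α β).mul u v = modelProduct α β u v := rfl

theorem modelBasis_hasP (α β : F) : (modelBasis α β).HasP α β where
  xxx i j k := by
    simp only [StandardBasis.x, modelBasis, Pi.basisFun_apply, model_mul]
    simp only [model, modelForm_single_inl]
    fin_cases k <;> simp [modelProduct, minor]
  xxy i j k := by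
    simp only [StandardBasis.x, StandardBasis.y, modelBasis, Pi.basisFun_apply, model_mul]
    simp only [model, modelForm_single_inr]
    fin_cases k <;> simp [modelProduct, minor]
  xyy i j k hij hjk := by
    simp only [StandardBasis.x, StandardBasis.y, modelBasis, Pi.basisFun_apply, model_mul]
    simp only [model, modelForm_single_inr]
    fin_cases i <;> fin_cases j <;> first | (exfalso; revert hij; decide) | skip
    all_goals fin_cases k <;> first | (exfalso; revert hjk; decide) | skip
    all_goals simp [modelProduct, minor, coeffX]
  xyy_zero i j k hji := by
    simp only [StandardBasis.x, StandardBasis.y, modelBasis, Pi.basisFun_apply, model_mul]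
    simp only [model, modelForm_single_inr]
    fin_cases i <;> fin_cases j <;> first | (exfalso; revert hji; decide) | skip
    all_goals fin_cases k <;> simp [modelProduct, minor]
  yyy i j k hij hjk := by
    simp only [StandardBasis.y, modelBasis, Pi.basisFun_apply, model_mul]
    simp only [model, modelForm_single_inr]
    fin_cases i <;> fin_cases j <;> first | (exfalso; revert hij; decide) | skip
    all_goals fin_cases k <;> first | (exfalso; revert hjk; decide) | skip
    all_goals simp [modelProduct, minor, coeffY]

end Model

namespace StandardBasis

variable {F L : Type*} [Field F] [AddCommGroup L] [Module F L] {S : SAA F L}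
  {b : S.StandardBasis 5} {α β : F}

/-- The isomorphism with the model given by uniqueness is the coordinate map itself, so every
product can be computed in the model. -/
theorem HasP.repr_mul (h : b.HasP α β) (u v : L) :
    ⇑(b.basis.repr (S.mul u v)) = modelProduct α β (b.basis.repr u) (b.basis.repr v) := by
  have key : ∀ w : L,
      (StandardBasis.HasPresentation.iso h (modelBasis_hasP α β)).toEquiv w =
        ⇑(b.basis.repr w) := fun w => by
    change b.basis.equiv (Pi.basisFun F _) (Equiv.refl _) w = _
    ext p
    have : (Pi.basisFun F (Fin 5 ⊕ Fin 5)).repr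
        (b.basis.equiv (Pi.basisFun F _) (Equiv.refl _) w) = b.basis.repr w := by
      simp [Module.Basis.equiv]
    simpa using congrArg (fun f => f p) this
  have := (StandardBasis.HasPresentation.iso h (modelBasis_hasP α β)).map_mul u v
  rwa [key, key, key, model_mul] at this

theorem form_eq_modelForm {n : ℕ} (b : S.StandardBasis n) (u v : L) :
    S.form u v = modelForm (b.basis.repr u) (b.basis.repr v) := by
  have : S.form = modelForm.compl₁₂ b.basis.equivFun.toLinearMap
      b.basis.equivFun.toLinearMap :=
    LinearMap.ext_basis b.basis b.basis fun p q => by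
      rcases p with i | i <;> rcases q with j | j <;>
        simp [form_x_x, form_y_y, form_x_y, form_y_x, modelForm_apply, Finsupp.single_apply,
          eq_comm]
  exact congrArg (fun B => B u v) this

theorem HasP.form_mul (h : b.HasP α β) (u v w : L) :
    S.form (S.mul u v) w =
      modelForm (modelProduct α β (b.basis.repr u) (b.basis.repr v)) (b.basis.repr w) := by
  rw [b.form_eq_modelForm, h.repr_mul]

end StandardBasis

end SAA

/-! ### Irreducible parameters give type C -/

namespace SAA

theorem nondegenerate_of_alt {F V : Type*} [Field F] [AddCommGroup V] [Module F V]
    {B : LinearMap.BilinForm F V} (halt : ∀ u, B u u = 0)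
    (h : ∀ u, (∀ v, B u v = 0) → u = 0) : B.Nondegenerate :=
  (LinearMap.IsRefl.nondegenerate_iff_separatingLeft
    (LinearMap.IsAlt.isRefl (show LinearMap.IsAlt B from halt))).2 h

/-- A monic quadratic polynomial over a field is irreducible iff it has no root. -/
theorem irreducible_quadratic_iff {F : Type*} [Field F] (α β : F) :
    Irreducible (Polynomial.X ^ 2 + Polynomial.C α * Polynomial.X + Polynomial.C β) ↔
      ∀ t : F, t ^ 2 + α * t + β ≠ 0 := by
  have hd : (Polynomial.X ^ 2 + Polynomial.C α * Polynomial.X + Polynomial.C β).natDegree = 2 := by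
    compute_degree!
  rw [Polynomial.irreducible_iff_roots_eq_zero_of_degree_le_three (by omega) (by omega),
    Multiset.eq_zero_iff_forall_notMem]
  have h0 : (Polynomial.X ^ 2 + Polynomial.C α * Polynomial.X + Polynomial.C β) ≠ 0 := by
    intro h; rw [h] at hd; simp at hd
  simp [Polynomial.mem_roots h0]

/-- Dehomogenise at `t = s / r`; for `r = 0` only `s²` survives. The form is the Pfaffian of `φ_z̄`
at `z = r x₁ + s y₁`. -/
theorem quadratic_form_ne_zero {F : Type*} [Field F] {α β : F}
    (h : ∀ t : F, t ^ 2 + α * t + β ≠ 0) {r s : F} (hrs : r ≠ 0 ∨ s ≠ 0) :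
    s ^ 2 + α * r * s + β * r ^ 2 ≠ 0 := by
  intro h0
  by_cases hr : r = 0
  · subst hr
    simp_all
  · apply h (s / r)
    field_simp
    linear_combination h0

section Center

variable {F L : Type*} [Field F] [AddCommGroup L] [Module F L]

theorem mem_center {S : SAA F L} {z : L} : z ∈ S.center ↔ ∀ u, S.mul z u = 0 := by
  rw [center, LinearMap.mem_ker, LinearMap.ext_iff]
  rfl

theorem mul_mem_power_two (S : SAA F L) (u v : L) : S.mul u v ∈ S.power 2 :=
  Submodule.apply_mem_map₂ _ Submodule.mem_top Submodule.mem_top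

end Center

namespace StandardBasis

variable {F L : Type*} [Field F] [AddCommGroup L] [Module F L] {S : SAA F L}
  {b : S.StandardBasis 5} {α β : F}

theorem repr_x {n : ℕ} (b : S.StandardBasis n) (i : Fin n) :
    b.basis.repr (b.x i) = Finsupp.single (.inl i) 1 := b.basis.repr_self _

theorem repr_y {n : ℕ} (b : S.StandardBasis n) (i : Fin n) :
    b.basis.repr (b.y i) = Finsupp.single (.inr i) 1 := b.basis.repr_self _

theorem eq_sum {n : ℕ} (b : S.StandardBasis n) (u : L) :
    u = ∑ i, b.basis.repr u (.inl i) • b.x i + ∑ i, b.basis.repr u (.inr i) • b.y i := by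
  conv_lhs => rw [← b.basis.sum_repr u]
  rw [Fintype.sum_sum_type]
  rfl

theorem HasP.y_mul_y_one_four (h : b.HasP α β) : S.mul (b.y 1) (b.y 4) = b.x 0 := by
  apply b.basis.repr.injective
  refine DFunLike.coe_injective ?_
  rw [h.repr_mul, repr_x, repr_y, repr_y]
  ext p
  rcases p with i | i <;> fin_cases i <;> simp [modelProduct, minor]

theorem HasP.y_mul_y_two_one (h : b.HasP α β) : S.mul (b.y 2) (b.y 1) = b.y 0 := by
  apply b.basis.repr.injective
  refine DFunLike.coe_injective ?_
  rw [h.repr_mul, repr_y, repr_y, repr_y]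
  ext p
  rcases p with i | i <;> fin_cases i <;> simp [modelProduct, minor]

theorem HasP.y_zero_mul (h : b.HasP α β) :
    S.mul (b.y 0) (b.y 4) = -b.x 1 ∧ S.mul (b.y 0) (b.y 3) = -b.x 2 ∧
      S.mul (b.y 0) (b.y 2) = b.x 3 ∧ S.mul (b.y 0) (b.y 1) = b.x 4 := by
  refine ⟨?_, ?_, ?_, ?_⟩ <;> apply b.basis.repr.injective <;>
    refine DFunLike.coe_injective ?_ <;>
    simp only [h.repr_mul, map_neg, repr_x, repr_y] <;> ext p <;>
    rcases p with i | i <;> fin_cases i <;> simp [modelProduct, minor]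

theorem HasP.x_zero_mem (h : b.HasP α β) : b.x 0 ∈ S.power 2 :=
  h.y_mul_y_one_four ▸ S.mul_mem_power_two _ _

theorem HasP.y_zero_mem (h : b.HasP α β) : b.y 0 ∈ S.power 2 :=
  h.y_mul_y_two_one ▸ S.mul_mem_power_two _ _

theorem HasP.x_succ_mem_power_three (h : b.HasP α β) (i : Fin 4) :
    b.x i.succ ∈ S.power 3 := by
  have key := fun j => S.mul_mem_power_three h.y_zero_mem (b.y j)
  obtain ⟨h1, h2, h3, h4⟩ := h.y_zero_mul
  fin_cases i
  · exact neg_mem_iff.1 (h1 ▸ key 4)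
  · exact neg_mem_iff.1 (h2 ▸ key 3)
  · exact h3 ▸ key 2
  · exact h4 ▸ key 1

theorem HasP.repr_inr_succ (h : b.HasP α β) {z : L} (hz : z ∈ S.power 2) (i : Fin 4) :
    b.basis.repr z (.inr i.succ) = 0 := by
  have hle : S.power 2 ≤ LinearMap.ker (b.basis.coord (.inr i.succ)) := by
    refine Submodule.map₂_le.2 fun u _ v _ => ?_
    rw [LinearMap.mem_ker, Module.Basis.coord_apply, h.repr_mul]
    fin_cases i <;> simp [modelProduct]
  exact hle hz

theorem HasP.mul_mem_power_two_mem_center (h : b.HasP α β) {z : L} (hz : z ∈ S.power 2) (u : L) :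
    S.mul z u ∈ S.center := by
  rw [mem_center]
  intro v
  apply b.basis.repr.injective
  refine DFunLike.coe_injective ?_
  rw [h.repr_mul, h.repr_mul]
  have h1 := h.repr_inr_succ hz 0
  have h2 := h.repr_inr_succ hz 1
  have h3 := h.repr_inr_succ hz 2
  have h4 := h.repr_inr_succ hz 3
  simp only [Fin.reduceSucc] at h1 h2 h3 h4
  ext p
  rcases p with i | i <;> fin_cases i <;> simp [modelProduct, minor, h1, h2, h3, h4]

theorem HasP.x_succ_mem_center (h : b.HasP α β) (i : Fin 4) : b.x i.succ ∈ S.center := by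
  obtain ⟨h1, h2, h3, h4⟩ := h.y_zero_mul
  have key := fun j => h.mul_mem_power_two_mem_center h.y_zero_mem (b.y j)
  fin_cases i
  · exact neg_mem_iff.1 (h1 ▸ key 4)
  · exact neg_mem_iff.1 (h2 ▸ key 3)
  · exact h3 ▸ key 2
  · exact h4 ▸ key 1

/-- The centre is orthogonal to `L²`, which contains `y₁` and all the `xᵢ`; pairing with these reads
off the coordinates. -/
theorem HasP.repr_of_mem_center (h : b.HasP α β) {z : L} (hz : z ∈ S.center) :
    b.basis.repr z (.inl 0) = 0 ∧ ∀ i, b.basis.repr z (.inr i) = 0 := by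
  have key : ∀ w ∈ S.power 2, S.form w z = 0 := fun w hw => S.form_power_two_center hw hz
  refine ⟨?_, fun i => ?_⟩
  · rw [repr_inl, S.form_skew, key _ h.y_zero_mem, neg_zero]
  · rw [repr_inr]
    refine Fin.cases (key _ h.x_zero_mem) (fun i => key _ ?_) i
    have := h.y_zero_mul
    fin_cases i
    · exact neg_mem_iff.1 (this.1 ▸ S.mul_mem_power_two _ _)
    · exact neg_mem_iff.1 (this.2.1 ▸ S.mul_mem_power_two _ _)
    · exact this.2.2.1 ▸ S.mul_mem_power_two _ _
    · exact this.2.2.2 ▸ S.mul_mem_power_two _ _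

theorem HasP.center_eq_span (h : b.HasP α β) :
    S.center = Submodule.span F (Set.range fun i : Fin 4 => b.x i.succ) := by
  apply le_antisymm
  · intro z hz
    obtain ⟨h0, hy⟩ := h.repr_of_mem_center hz
    rw [b.eq_sum z, Fin.sum_univ_succ, h0]
    simp only [hy, zero_smul, Finset.sum_const_zero, add_zero, zero_add]
    exact Submodule.sum_mem _ fun i _ =>
      Submodule.smul_mem _ _ (Submodule.subset_span ⟨i, rfl⟩)
  · rw [Submodule.span_le]
    rintro _ ⟨i, rfl⟩
    exact h.x_succ_mem_center i

theorem HasP.power_three_eq (h : b.HasP α β) : S.power 3 = S.center := by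
  apply le_antisymm
  · exact Submodule.map₂_le.2 fun z hz u _ => h.mul_mem_power_two_mem_center hz u
  · rw [h.center_eq_span, Submodule.span_le]
    rintro _ ⟨i, rfl⟩
    exact h.x_succ_mem_power_three i

theorem HasP.mem_power_two_of_repr (h : b.HasP α β) {z : L}
    (hz : ∀ i : Fin 4, b.basis.repr z (.inr i.succ) = 0) : z ∈ S.power 2 := by
  have hx : ∀ i, b.x i ∈ S.power 2 := Fin.cases h.x_zero_mem fun i => by
    have := h.y_zero_mul
    fin_cases i
    · exact neg_mem_iff.1 (this.1 ▸ S.mul_mem_power_two _ _)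
    · exact neg_mem_iff.1 (this.2.1 ▸ S.mul_mem_power_two _ _)
    · exact this.2.2.1 ▸ S.mul_mem_power_two _ _
    · exact this.2.2.2 ▸ S.mul_mem_power_two _ _
  rw [b.eq_sum z, Fin.sum_univ_succ (fun i => b.basis.repr z (.inr i) • b.y i)]
  simp only [hz, zero_smul, Finset.sum_const_zero, add_zero]
  exact add_mem (Submodule.sum_mem _ fun i _ => Submodule.smul_mem _ _ (hx i))
    (Submodule.smul_mem _ _ h.y_zero_mem)

theorem HasP.mem_center_of_repr (h : b.HasP α β) {z : L} (hz : z ∈ S.power 2)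
    (hx : b.basis.repr z (.inl 0) = 0) (hy : b.basis.repr z (.inr 0) = 0) : z ∈ S.center := by
  rw [b.eq_sum z, Fin.sum_univ_succ (fun i => b.basis.repr z (.inl i) • b.x i),
    Fin.sum_univ_succ (fun i => b.basis.repr z (.inr i) • b.y i), hx, hy]
  simp only [h.repr_inr_succ hz, zero_smul, Finset.sum_const_zero, add_zero, zero_add]
  exact Submodule.sum_mem _ fun i _ => Submodule.smul_mem _ _ (h.x_succ_mem_center i)

/-- The value `(z u, v)` for `z ∈ L²` in coordinates. -/
theorem HasP.form_mul_of_mem (h : b.HasP α β) {z : L} (hz : z ∈ S.power 2) (u v : L) :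
    S.form (S.mul z u) v =
      b.basis.repr z (.inl 0) * minor (.inr 1) (.inr 2) (b.basis.repr u) (b.basis.repr v) +
      b.basis.repr z (.inr 0) * minor (.inr 1) (.inr 4) (b.basis.repr u) (b.basis.repr v) +
      (α * b.basis.repr z (.inl 0) + b.basis.repr z (.inr 0)) *
        minor (.inr 2) (.inr 3) (b.basis.repr u) (b.basis.repr v) +
      β * b.basis.repr z (.inl 0) *
        minor (.inr 3) (.inr 4) (b.basis.repr u) (b.basis.repr v) := by
  have h1 := h.repr_inr_succ hz 0
  have h2 := h.repr_inr_succ hz 1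
  have h3 := h.repr_inr_succ hz 2
  have h4 := h.repr_inr_succ hz 3
  simp only [Fin.reduceSucc] at h1 h2 h3 h4
  rw [S.cyclic, h.form_mul, modelForm_modelProduct, h1, h2, h3, h4]
  simp only [minor]
  ring

/-- The Pfaffian adjugate of the Gram matrix of `φ_z̄` turns `φ_z̄ (u, ·) = 0` into Pfaffian times
each coordinate of `u` modulo `L²` being zero, and the Pfaffian is non-zero. -/
theorem HasP.mem_power_two_of_form_mul (h : b.HasP α β) (hαβ : ∀ t : F, t ^ 2 + α * t + β ≠ 0)
    {z : L} (hz : z ∈ S.power 2) (hzc : z ∉ S.center) {u : L}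
    (hu : ∀ v, S.form (S.mul z u) v = 0) : u ∈ S.power 2 := by
  have hrs : b.basis.repr z (.inl 0) ≠ 0 ∨ b.basis.repr z (.inr 0) ≠ 0 := by
    by_contra! hcon
    exact hzc (h.mem_center_of_repr hz hcon.1 hcon.2)
  have hpf := quadratic_form_ne_zero hαβ hrs
  have key := fun j => (h.form_mul_of_mem hz u (b.y j)).symm.trans (hu (b.y j))
  have k1 := key 1
  have k2 := key 2
  have k3 := key 3
  have k4 := key 4
  simp only [repr_y, minor, Finsupp.single_apply, Sum.inr.injEq, Fin.reduceEq, if_true,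
    if_false] at k1 k2 k3 k4
  refine h.mem_power_two_of_repr fun i => (mul_eq_zero.1 ?_).resolve_left hpf
  fin_cases i <;> simp only [Fin.mk_zero, Fin.mk_one, Fin.reduceFinMk, Fin.reduceSucc]
  all_goals
    generalize b.basis.repr z (.inl 0) = r at *
    generalize b.basis.repr z (.inr 0) = s at *
  -- The coefficients in these four combinations are the rows of the Pfaffian adjugate.
  · linear_combination β * r * k2 + (s + α * r) * k4
  · linear_combination - β * r * k1 + s * k3
  · linear_combination - s * k2 + r * k4
  · linear_combination - (s + α * r) * k1 - r * k3

theorem HasP.isTypeC (h : b.HasP α β) (hαβ : ∀ t : F, t ^ 2 + α * t + β ≠ 0) : S.IsTypeC where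
  finrank_eq := by
    rw [Module.finrank_eq_card_basis b.basis]
    simp
  nilpotent := by
    -- The witness 3 stands for `L⁴ = 0`, as nilpotency is stated with `n.succ`.
    refine ⟨3, le_bot_iff.1 (Submodule.map₂_le.2 fun z hz u _ => ?_)⟩
    exact mem_center.1 (h.power_three_eq ▸ hz) u
  center_isotropic := fun u hu v hv =>
    S.form_power_two_center
      (h.mem_power_two_of_repr fun i => (h.repr_of_mem_center hu).2 i.succ) hv
  finrank_center := by
    have hli : LinearIndependent F fun i : Fin 4 => b.x i.succ :=
      b.basis.linearIndependent.comp (fun i : Fin 4 => Sum.inl i.succ)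
        fun i j hij => Fin.succ_injective _ (Sum.inl_injective hij)
    rw [h.center_eq_span, finrank_span_eq_card hli]
    simp
  power_three_eq := h.power_three_eq
  phi_nondegenerate := by
    intro z hz
    obtain ⟨z, rfl⟩ := Submodule.Quotient.mk_surjective _ z
    have hzc : (z : L) ∉ S.center := fun hc => hz ((Submodule.Quotient.mk_eq_zero _).2 hc)
    refine nondegenerate_of_alt (fun u => ?_) fun u hu => ?_
    · obtain ⟨u, rfl⟩ := Submodule.Quotient.mk_surjective _ u
      rw [phi_mk, S.form_mul_self_right]
    · obtain ⟨u, rfl⟩ := Submodule.Quotient.mk_surjective _ u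
      rw [Submodule.Quotient.mk_eq_zero]
      refine h.mem_power_two_of_form_mul hαβ z.2 hzc fun v => ?_
      have := hu (Submodule.Quotient.mk v)
      rwa [phi_mk] at this

end StandardBasis

end SAA

/-! ### The Pfaffian and the change of parameters -/

namespace SAA

/-- This is `Pf (G M Gᵀ) = det G · Pf M`, with `G` the matrix with rows `gᵢ` and `M` the Gram matrix
of `φ_z̄` at `z̄ = ρ x̄₁ + σ ȳ₁`. -/
theorem pfaffian_substitution {F : Type*} [CommRing F] (α β ρ σ : F)
    (g₁ g₂ g₃ g₄ : Fin 5 ⊕ Fin 5 → F) (B : (Fin 5 ⊕ Fin 5 → F) → (Fin 5 ⊕ Fin 5 → F) → F)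
    (hB : ∀ u v, B u v =
      ρ * (u (.inr 1) * v (.inr 2) - u (.inr 2) * v (.inr 1)) +
      σ * (u (.inr 1) * v (.inr 4) - u (.inr 4) * v (.inr 1)) +
      (α * ρ + σ) * (u (.inr 2) * v (.inr 3) - u (.inr 3) * v (.inr 2)) +
      β * ρ * (u (.inr 3) * v (.inr 4) - u (.inr 4) * v (.inr 3))) :
    B g₁ g₂ * B g₃ g₄ - B g₁ g₃ * B g₂ g₄ + B g₁ g₄ * B g₂ g₃ =
      Matrix.det !![g₁ (.inr 1), g₁ (.inr 2), g₁ (.inr 3), g₁ (.inr 4);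
        g₂ (.inr 1), g₂ (.inr 2), g₂ (.inr 3), g₂ (.inr 4);
        g₃ (.inr 1), g₃ (.inr 2), g₃ (.inr 3), g₃ (.inr 4);
        g₄ (.inr 1), g₄ (.inr 2), g₄ (.inr 3), g₄ (.inr 4)] *
        (σ ^ 2 + α * ρ * σ + β * ρ ^ 2) := by
  simp only [hB, Matrix.det_succ_row_zero, Fin.sum_univ_succ]
  simp [Fin.succAbove, Matrix.submatrix]
  ring

namespace StandardBasis

variable {F L : Type*} [Field F] [AddCommGroup L] [Module F L] {S : SAA F L}
  {b b' : S.StandardBasis 5} {α β α' β' : F}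

/-- How the parameters of the presentation change under a change of standard basis. -/
theorem HasP.parameters_eq (h : b.HasP α β) (h' : b'.HasP α' β') {a₁ a₂ a₃ a₄ : F}
    (h₁ : b.basis.repr (b'.x 0) (.inl 0) = a₁) (h₂ : b.basis.repr (b'.x 0) (.inr 0) = a₂)
    (h₃ : b.basis.repr (b'.y 0) (.inl 0) = a₃) (h₄ : b.basis.repr (b'.y 0) (.inr 0) = a₄) :
    a₁ * a₄ - a₂ * a₃ = 1 ∧
      α' = ((a₁ * a₄ + a₂ * a₃) * α + 2 * a₁ * a₃ * β + 2 * a₂ * a₄) /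
        (a₄ ^ 2 + α * a₃ * a₄ + a₃ ^ 2 * β) ∧
      β' = (a₂ ^ 2 + a₁ * a₂ * α + a₁ ^ 2 * β) / (a₄ ^ 2 + a₃ * a₄ * α + a₃ ^ 2 * β) := by
  constructor
  · have hf : S.form (b'.x 0) (b'.y 0) = 1 := b'.form_x_y 0 0
    rw [b.form_eq_modelForm, modelForm_apply, Fin.sum_univ_succ, h₁, h₂, h₃, h₄] at hf
    simpa [h.repr_inr_succ h'.x_zero_mem, h.repr_inr_succ h'.y_zero_mem] using hf
  -- The left side is the Pfaffian of `φ_z̄` at `z = r x₁' + s y₁'` in the new frame, the right side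
  -- the one in the old frame. The factor `D`, the determinant of the frame change on `L / L²`, is
  -- independent of `r` and `s`.
  obtain ⟨D, hD⟩ : ∃ D : F, ∀ r s : F,
      β' * r ^ 2 + s * (α' * r + s) = D * ((r * a₂ + s * a₄) ^ 2 +
        α * (r * a₁ + s * a₃) * (r * a₂ + s * a₄) + β * (r * a₁ + s * a₃) ^ 2) := by
    let g : Fin 4 → Fin 4 → F := fun i j => b.basis.repr (b'.y i.succ) (.inr j.succ)
    refine ⟨Matrix.det !![g 0 0, g 0 1, g 0 2, g 0 3; g 1 0, g 1 1, g 1 2, g 1 3;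
      g 2 0, g 2 1, g 2 2, g 2 3; g 3 0, g 3 1, g 3 2, g 3 3], fun r s => ?_⟩
    have hz : r • b'.x 0 + s • b'.y 0 ∈ S.power 2 :=
      add_mem (Submodule.smul_mem _ _ h'.x_zero_mem) (Submodule.smul_mem _ _ h'.y_zero_mem)
    have key := pfaffian_substitution α β (r * a₁ + s * a₃) (r * a₂ + s * a₄)
      (b.basis.repr (b'.y 1)) (b.basis.repr (b'.y 2)) (b.basis.repr (b'.y 3))
      (b.basis.repr (b'.y 4)) _ fun _ _ => rfl
    have hval : ∀ i j, _ = _ := fun i j =>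
      (h'.form_mul_of_mem hz (b'.y i) (b'.y j)).symm.trans
        (h.form_mul_of_mem hz (b'.y i) (b'.y j))
    simp only [map_add, map_smul, Finsupp.add_apply, Finsupp.smul_apply, smul_eq_mul, h₁, h₂, h₃,
      h₄] at hval
    have h12 := hval 1 2
    have h13 := hval 1 3
    have h14 := hval 1 4
    have h23 := hval 2 3
    have h24 := hval 2 4
    have h34 := hval 3 4
    simp only [minor] at h12 h13 h14 h23 h24 h34
    rw [← h12, ← h13, ← h14, ← h23, ← h24, ← h34] at key
    refine Eq.trans ?_ key
    simp [repr_x, repr_y]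
    ring
  -- Comparing coefficients: `(0, 1)` says that `D` times the common denominator is 1, `(1, 0)`
  -- gives `β'`, and `(1, 1)` minus the other two gives `α'`.
  have h01 := hD 0 1
  have h10 := hD 1 0
  have h11 := hD 1 1
  have hne : a₄ ^ 2 + α * a₃ * a₄ + a₃ ^ 2 * β ≠ 0 := fun h0 => by
    apply one_ne_zero (α := F)
    linear_combination h01 + D * h0
  have hne' : a₄ ^ 2 + a₃ * a₄ * α + a₃ ^ 2 * β ≠ 0 := fun h0 => hne (by linear_combination h0)
  constructor
  · rw [eq_div_iff hne]
    linear_combination (h11 - h10 - h01) * (a₄ ^ 2 + α * a₃ * a₄ + a₃ ^ 2 * β) -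
      h01 * ((a₁ * a₄ + a₂ * a₃) * α + 2 * a₁ * a₃ * β + 2 * a₂ * a₄)
  · rw [eq_div_iff hne']
    linear_combination h10 * (a₄ ^ 2 + α * a₃ * a₄ + a₃ ^ 2 * β) -
      h01 * (a₂ ^ 2 + a₁ * a₂ * α + a₁ ^ 2 * β)

end StandardBasis
end SAA

/-! ### Normal form of the pencil for an algebra of type C -/

namespace SAA

/-- Normal form of a pencil of alternating forms, given enough vectors on which it does not
degenerate. -/
theorem exists_pencil_frame {F L : Type*} [Field F] [AddCommGroup L] [Module F L]
    {A B : LinearMap.BilinForm F L} (hA : ∀ u, A u u = 0) (hB : ∀ u, B u u = 0) {y₁ y₃ w w' : L}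
    (h₃ : ∀ v, B y₃ v = -A y₁ v) (hw : B y₁ w = 1) (hw' : A y₁ w' + B y₃ w * B y₁ w' = 1) :
    ∃ (α β : F) (y : Fin 4 → L), ∀ i j, i < j →
      A (y i) (y j) = coeffX α β 0 i.succ j.succ ∧ B (y i) (y j) = coeffY F 0 i.succ j.succ := by
  have hAs : ∀ u v, A u v = -A v u := fun u v => (LinearMap.IsAlt.neg hA v u).symm
  have hBs : ∀ u v, B u v = -B v u := fun u v => (LinearMap.IsAlt.neg hB v u).symm
  obtain ⟨y₂, hB12, hB32⟩ : ∃ y₂, B y₁ y₂ = 0 ∧ B y₃ y₂ = -1 := by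
    -- Subtracting a multiple of `w` enforces `B y₁ y₂ = 0`; `hw'` is the condition that then makes
    -- `B y₃ y₂ = -1`.
    refine ⟨w' - B y₁ w' • w, by simp [hw], ?_⟩
    simp only [map_sub, map_smul, smul_eq_mul]
    linear_combination h₃ w' - hw'
  have hB13 : B y₁ y₃ = 0 := by rw [hBs, h₃, hA]; simp
  have hA13 : A y₁ y₃ = 0 := by rw [← neg_eq_zero, ← h₃, hB]
  have hA12 : A y₁ y₂ = 1 := by rw [← neg_inj, ← h₃, hB32]
  obtain ⟨v, hv1, hv3⟩ : ∃ v, B y₁ v = 1 ∧ B y₃ v = 0 :=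
    ⟨w + B y₃ w • y₂, by simp [hw, hB12], by simp [hB32]⟩
  obtain ⟨y₄, hB14, hB34, hB24, hA24⟩ :
      ∃ y₄, B y₁ y₄ = 1 ∧ B y₃ y₄ = 0 ∧ B y₂ y₄ = 0 ∧ A y₂ y₄ = 0 := by
    -- Since `B y₁ y₃ = 0`, adding `y₁` and `y₃` keeps the pairings of `v` with `y₁` and `y₃` under
    -- `B`; the `y₃` term kills `B y₂ y₄`, and then the `y₁` term kills `A y₂ y₄`.
    refine ⟨v + (A y₂ v - B y₂ v * A y₂ y₃) • y₁ - B y₂ v • y₃, ?_, ?_, ?_, ?_⟩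
    · simp [hv1, hB, hB13]
    · simp [hv3, hB, hBs y₃ y₁, hB13]
    · simp [hBs y₂ y₁, hB12, hBs y₂ y₃, hB32]
    · simp [hAs y₂ y₁, hA12]
  have hA14 : A y₁ y₄ = 0 := by rw [← neg_eq_zero, ← h₃, hB34]
  have hB23 : B y₂ y₃ = 1 := by rw [hBs, hB32, neg_neg]
  refine ⟨A y₂ y₃, A y₃ y₄, ![y₁, y₂, y₃, y₄], fun i j hij => ?_⟩
  fin_cases i <;> fin_cases j <;> first | (exfalso; revert hij; decide) | skip
  all_goals simp [coeffX, coeffY, hA12, hA13, hA14, hA24, hB12, hB13, hB14, hB23, hB24, hB34]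

section TypeC

variable {F L : Type*} [Field F] [AddCommGroup L] [Module F L] {S : SAA F L}

theorem mul_right_of_mem_center {c : L} (hc : c ∈ S.center) (u : L) : S.mul u c = 0 := by
  rw [S.mul_skew, mem_center.1 hc, neg_zero]

/-- The centre annihilates products and is orthogonal to `L²`, so central corrections of a basis are
free. -/
theorem form_mul_congr {u u' v v' w w' : L} (hu : u - u' ∈ S.center) (hv : v - v' ∈ S.center)
    (hw : w - w' ∈ S.center) : S.form (S.mul u v) w = S.form (S.mul u' v') w' := by
  have hm : S.mul u v = S.mul u' v' := by
    have h1 := mem_center.1 hu v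
    have h2 := mul_right_of_mem_center hv u'
    simp only [map_sub, LinearMap.sub_apply, sub_eq_zero] at h1 h2
    rw [h1, h2]
  have h3 := S.form_power_two_center (S.mul_mem_power_two u v) hw
  rw [map_sub, sub_eq_zero] at h3
  rw [h3, hm]

/-- Translation of the arguments of the triple product by multiples of one vector. -/
theorem form_mul_add_smul (S : SAA F L) (u v w z : L) (p q r : F) :
    S.form (S.mul (u + p • z) (v + q • z)) (w + r • z) =
      S.form (S.mul u v) w + p * S.form (S.mul z v) w - q * S.form (S.mul z u) w +
        r * S.form (S.mul z u) v := by
  simp only [map_add, map_smul, LinearMap.add_apply, LinearMap.smul_apply, smul_eq_mul,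
    form_mul_self_left, form_mul_self_right, form_mul_self_outer]
  rw [S.form_mul_swap u z w, ← S.cyclic z u v]
  ring

theorem orthogonal_power_two (S : SAA F L) : S.form.orthogonal (S.power 2) = S.center := by
  ext w
  rw [LinearMap.BilinForm.mem_orthogonal_iff]
  constructor
  · intro h
    rw [mem_center]
    intro v
    refine S.form_nondegenerate.1 _ fun u => ?_
    rw [S.cyclic]
    exact h _ (S.mul_mem_power_two v u)
  · intro h u hu
    exact S.form_power_two_center hu h

namespace IsTypeC

theorem module_finite (h : S.IsTypeC) : Module.Finite F L :=
  Module.finite_of_finrank_pos (by rw [h.finrank_eq]; norm_num)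

theorem finrank_power_two (h : S.IsTypeC) : Module.finrank F (S.power 2) = 6 := by
  have := h.module_finite
  have h1 := LinearMap.BilinForm.finrank_orthogonal S.form_nondegenerate
    (S.power 2)
  rw [orthogonal_power_two, h.finrank_center, h.finrank_eq] at h1
  omega

/-- Otherwise `L²` is isotropic and lies in its orthogonal complement `Z(L)`, against `6 > 4`. -/
theorem exists_form_eq_one (h : S.IsTypeC) :
    ∃ z₁ ∈ S.power 2, ∃ z₂ ∈ S.power 2, S.form z₁ z₂ = 1 := by
  have := h.module_finite
  by_contra! hcon
  have hle : S.power 2 ≤ S.center := by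
    rw [← orthogonal_power_two]
    intro z hz w hw
    by_contra hne
    refine hcon w hw ((S.form w z)⁻¹ • z) (Submodule.smul_mem _ _ hz) ?_
    rw [map_smul, smul_eq_mul, inv_mul_cancel₀ hne]
  have := Submodule.finrank_mono hle
  rw [h.finrank_power_two, h.finrank_center] at this
  omega

theorem exists_form_mul_eq_one (h : S.IsTypeC) {z u : L} (hz : z ∈ S.power 2)
    (hzc : z ∉ S.center) (hu : u ∉ S.power 2) : ∃ v, S.form (S.mul z u) v = 1 := by
  by_contra! hcon
  have hnd := h.phi_nondegenerate (Submodule.Quotient.mk ⟨z, hz⟩)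
    (fun h0 => hzc ((Submodule.Quotient.mk_eq_zero (S.center.submoduleOf (S.power 2))).1 h0))
  refine hu ((Submodule.Quotient.mk_eq_zero _).1 (hnd.1 (Submodule.Quotient.mk u) fun v => ?_))
  obtain ⟨v, rfl⟩ := Submodule.Quotient.mk_surjective _ v
  rw [phi_mk]
  by_contra hne
  refine hcon ((S.form (S.mul z u) v)⁻¹ • v) ?_
  rw [map_smul, smul_eq_mul]
  exact inv_mul_cancel₀ hne

theorem exists_form_mul_eq (h : S.IsTypeC) {z : L} (hz : z ∈ S.power 2) (hzc : z ∉ S.center)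
    (f : Module.Dual F L) (hf : S.power 2 ≤ LinearMap.ker f) :
    ∃ u, ∀ v, S.form (S.mul z u) v = f v := by
  have := h.module_finite
  have hnd := h.phi_nondegenerate (Submodule.Quotient.mk ⟨z, hz⟩)
    (fun h0 => hzc ((Submodule.Quotient.mk_eq_zero (S.center.submoduleOf (S.power 2))).1 h0))
  obtain ⟨u, hu⟩ := (LinearMap.BilinForm.toDual _ hnd).surjective ((S.power 2).liftQ f hf)
  obtain ⟨u, rfl⟩ := Submodule.Quotient.mk_surjective _ u
  refine ⟨u, fun v => ?_⟩
  have := congrArg (fun g => g (Submodule.Quotient.mk v)) hu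
  simpa only [LinearMap.BilinForm.toDual_def, phi_mk, Submodule.liftQ_apply] using this

theorem mul_mem_center (h : S.IsTypeC) {z : L} (hz : z ∈ S.power 2) (u : L) :
    S.mul z u ∈ S.center := h.power_three_eq ▸ S.mul_mem_power_three hz u

theorem notMem_center (S : SAA F L) {z w : L} (hw : w ∈ S.power 2) (h : S.form w z ≠ 0) :
    z ∉ S.center := fun hz => h (S.form_power_two_center hw hz)

theorem exists_frame (h : S.IsTypeC) {z₁ z₂ : L} (hz₁ : z₁ ∈ S.power 2) (hz₂ : z₂ ∈ S.power 2)
    (hz : S.form z₁ z₂ = 1) :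
    ∃ (α β : F) (y : Fin 4 → L), ∀ i j, i < j →
      S.form (S.mul z₁ (y i)) (y j) = coeffX α β 0 i.succ j.succ ∧
        S.form (S.mul z₂ (y i)) (y j) = coeffY F 0 i.succ j.succ := by
  have hz₂c : z₂ ∉ S.center := notMem_center S hz₁ (by simp [hz])
  obtain ⟨y₁, hy₁⟩ : ∃ y₁, S.mul z₂ y₁ ≠ 0 := by
    by_contra! hcon
    exact hz₂c (mem_center.2 hcon)
  have hy₁ : y₁ ∉ S.power 2 := fun hy =>
    hy₁ (S.mul_eq_zero_of_mem_power_two h.power_three_eq hz₂ hy)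
  obtain ⟨y₃, hy₃⟩ := h.exists_form_mul_eq hz₂ hz₂c (-S.form (S.mul z₁ y₁)) fun v hv => by
    rw [LinearMap.mem_ker, LinearMap.neg_apply, S.form_skew,
      S.form_power_two_center hv (h.mul_mem_center hz₁ y₁), neg_zero, neg_zero]
  obtain ⟨w, hw⟩ := h.exists_form_mul_eq_one hz₂ hz₂c hy₁
  -- The coefficient is the `B y₃ w` of `exists_pencil_frame`. Pairing with `z₂` gives `-1`, so this
  -- member of the pencil is non-degenerate and supplies `w'`.
  have hzk : z₁ + S.form (S.mul z₂ y₃) w • z₂ ∉ S.center :=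
    notMem_center S hz₂ (by simp [S.form_alt, S.form_skew z₂ z₁, hz])
  obtain ⟨w', hw'⟩ := h.exists_form_mul_eq_one
    (add_mem hz₁ (Submodule.smul_mem _ _ hz₂)) hzk hy₁
  exact exists_pencil_frame (A := LinearMap.comp S.form (S.mul z₁))
    (B := LinearMap.comp S.form (S.mul z₂))
    (fun u => S.form_mul_self_right z₁ u) (fun u => S.form_mul_self_right z₂ u)
    hy₃ hw (by simpa using hw')

end IsTypeC
end TypeC
end SAA

/-! ### From the frame to a standard basis, and the classification -/

namespace SAA

section Construction

variable {F L : Type*} [Field F] [AddCommGroup L] [Module F L] {S : SAA F L}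

theorem linearIndependent_of_form (S : SAA F L) {n : ℕ} {x y : Fin n → L}
    (hxx : ∀ i j, S.form (x i) (x j) = 0) (hyy : ∀ i j, S.form (y i) (y j) = 0)
    (hxy : ∀ i j, S.form (x i) (y j) = if i = j then 1 else 0) :
    LinearIndependent F (Sum.elim x y) := by
  rw [Fintype.linearIndependent_iff]
  intro g hg
  rw [Fintype.sum_sum_type] at hg
  simp only [Sum.elim_inl, Sum.elim_inr] at hg
  rintro (i | i)
  · simpa [hxy, hyy, S.form_skew] using congrArg (fun u => S.form u (y i)) hg
  · simpa [hxy, hxx] using congrArg (S.form (x i)) hg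

/-- Vectors with the standard Gram matrix form a standard basis if there are enough of them. -/
noncomputable def StandardBasis.ofVectors {n : ℕ} [NeZero n] (x y : Fin n → L)
    (hxx : ∀ i j, S.form (x i) (x j) = 0) (hyy : ∀ i j, S.form (y i) (y j) = 0)
    (hxy : ∀ i j, S.form (x i) (y j) = if i = j then 1 else 0)
    (hn : Module.finrank F L = n + n) : S.StandardBasis n where
  basis := basisOfLinearIndependentOfCardEqFinrank (S.linearIndependent_of_form hxx hyy hxy)
    (by simp [hn])
  form_x_x i j := by simp [hxx]
  form_y_y i j := by simp [hyy]
  form_x_y i j := by simp [hxy]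

theorem StandardBasis.ofVectors_x {n : ℕ} [NeZero n] {x y : Fin n → L} {hxx hyy hxy hn}
    (i : Fin n) : (StandardBasis.ofVectors (S := S) x y hxx hyy hxy hn).x i = x i := by
  simp [StandardBasis.ofVectors, StandardBasis.x]

theorem StandardBasis.ofVectors_y {n : ℕ} [NeZero n] {x y : Fin n → L} {hxx hyy hxy hn}
    (i : Fin n) : (StandardBasis.ofVectors (S := S) x y hxx hyy hxy hn).y i = y i := by
  simp [StandardBasis.ofVectors, StandardBasis.y]

/-- Vectors dual to an isotropic family can be made isotropic by adding combinations of that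
family. -/
theorem exists_isotropic_translate (S : SAA F L) {n : ℕ} {x y : Fin n → L}
    (hxx : ∀ i j, S.form (x i) (x j) = 0)
    (hxy : ∀ i j, S.form (x i) (y j) = if i = j then 1 else 0) :
    ∃ c : Fin n → Fin n → F, ∀ i j,
      S.form (y i + ∑ k, c i k • x k) (y j + ∑ k, c j k • x k) = 0 := by
  have hyx : ∀ i j, S.form (y i) (x j) = -if j = i then 1 else 0 := fun i j => by
    rw [S.form_skew, hxy]
  -- The whole correction is put on the smaller index rather than split in halves, so characteristic
  -- 2 is covered.
  refine ⟨fun i k => if i < k then -S.form (y i) (y k) else 0, fun i j => ?_⟩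
  simp only [map_add, map_sum, map_smul, LinearMap.add_apply, LinearMap.sum_apply,
    LinearMap.smul_apply, hxx, hxy, hyx, smul_eq_mul, mul_zero, Finset.sum_const_zero,
    add_zero, mul_neg, mul_ite, mul_one, Finset.sum_ite_eq', Finset.mem_univ, if_true,
    Finset.sum_neg_distrib]
  rcases lt_trichotomy i j with hij | rfl | hij
  · simp [hij, hij.not_gt]
  · simp [S.form_alt]
  · simp [hij, hij.not_gt, S.form_skew (y i) (y j)]

theorem IsTypeC.exists_standardBasis (h : S.IsTypeC) {z₁ z₂ : L} (hz₁ : z₁ ∈ S.power 2)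
    (hz₂ : z₂ ∈ S.power 2) (hz : S.form z₁ z₂ = 1) {x y : Fin 4 → L} (hx : ∀ i, x i ∈ S.center)
    (hxy : ∀ i j, S.form (x i) (y j) = if i = j then 1 else 0) :
    ∃ b : S.StandardBasis 5, b.x 0 - z₁ ∈ S.center ∧ b.y 0 - z₂ ∈ S.center ∧
      (∀ i : Fin 4, b.x i.succ ∈ S.center) ∧ ∀ i : Fin 4, b.y i.succ - y i ∈ S.center := by
  have hxx : ∀ i j, S.form (x i) (x j) = 0 := fun i j => h.center_isotropic _ (hx i) _ (hx j)
  obtain ⟨c, hc⟩ := S.exists_isotropic_translate hxx hxy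
  have hsum : ∀ a : Fin 4 → F, ∑ k, a k • x k ∈ S.center := fun a =>
    Submodule.sum_mem _ fun k _ => Submodule.smul_mem _ _ (hx k)
  have hzx : ∀ {z}, z ∈ S.power 2 → ∀ {u}, u ∈ S.center → S.form z u = 0 := fun hz _ hu =>
    S.form_power_two_center hz hu
  have hxz : ∀ {z}, z ∈ S.power 2 → ∀ {u}, u ∈ S.center → S.form u z = 0 := fun hz _ hu => by
    rw [S.form_skew, hzx hz hu, neg_zero]
  have hcc : ∀ {u}, u ∈ S.center → ∀ {v}, v ∈ S.center → S.form u v = 0 := fun hu _ hv =>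
    h.center_isotropic _ hu _ hv
  -- This central correction makes `z` orthogonal to every `y k` and leaves the form on `L²`
  -- unchanged.
  let t : L → L := fun z => z - ∑ k, S.form z (y k) • x k
  have ht : ∀ z, t z - z ∈ S.center := fun z => by
    simp only [t, sub_sub_cancel_left]
    exact neg_mem (hsum _)
  have htt : ∀ {z}, z ∈ S.power 2 → ∀ {w}, w ∈ S.power 2 → S.form (t z) (t w) = S.form z w :=
    fun hz _ hw => by
      simp only [t, map_sub, LinearMap.sub_apply, hzx hz (hsum _), hxz hw (hsum _),
        hcc (hsum _) (hsum _), sub_zero]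
  have htx : ∀ {z}, z ∈ S.power 2 → ∀ {u}, u ∈ S.center → S.form (t z) u = 0 :=
    fun hz _ hu => by
      simp only [t, map_sub, LinearMap.sub_apply, hzx hz hu, hcc (hsum _) hu, sub_zero]
  have hty : ∀ {z}, z ∈ S.power 2 → ∀ i, S.form (t z) (y i + ∑ k, c i k • x k) = 0 :=
    fun {z} hz i => by
      rw [map_add, htx hz (hsum _)]
      simp [t, hxy]
  have hx' : ∀ u ∈ S.center, ∀ i, S.form u (y i + ∑ k, c i k • x k) = S.form u (y i) :=
    fun u hu i => by rw [map_add, hcc hu (hsum _), add_zero]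
  refine ⟨StandardBasis.ofVectors (Fin.cons (t z₁) x)
    (Fin.cons (t z₂) fun i => y i + ∑ k, c i k • x k) ?_ ?_ ?_ h.finrank_eq, ?_, ?_, ?_, ?_⟩
  · refine Fin.cases (Fin.cases ?_ fun j => ?_) fun i => Fin.cases ?_ fun j => ?_
    · exact S.form_alt _
    · exact htx hz₁ (hx j)
    · rw [S.form_skew, Fin.cons_zero, Fin.cons_succ, htx hz₁ (hx i), neg_zero]
    · exact hxx i j
  · refine Fin.cases (Fin.cases ?_ fun j => ?_) fun i => Fin.cases ?_ fun j => ?_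
    · exact S.form_alt _
    · exact hty hz₂ j
    · rw [S.form_skew, Fin.cons_zero, Fin.cons_succ, hty hz₂ i, neg_zero]
    · exact hc i j
  · refine Fin.cases (Fin.cases ?_ fun j => ?_) fun i => Fin.cases ?_ fun j => ?_
    · simpa [htt hz₁ hz₂] using hz
    · simpa [(Fin.succ_ne_zero j).symm] using hty hz₁ j
    · rw [S.form_skew, Fin.cons_zero, Fin.cons_succ, htx hz₂ (hx i), neg_zero,
        if_neg (Fin.succ_ne_zero i)]
    · simp only [Fin.cons_succ, hx' _ (hx i), hxy, Fin.succ_inj]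
  · simpa [StandardBasis.ofVectors_x] using ht z₁
  · simpa [StandardBasis.ofVectors_y] using ht z₂
  · intro i
    simpa [StandardBasis.ofVectors_x] using hx i
  · intro i
    simpa [StandardBasis.ofVectors_y] using hsum (c i)

theorem coeffX_succ (α β : F) (i : Fin 4) (j k : Fin 5) : coeffX α β i.succ j k = 0 := by
  fin_cases i <;> rfl

theorem coeffY_succ (i : Fin 4) (j k : Fin 5) : coeffY F i.succ j k = 0 := by
  fin_cases i <;> rfl

/-- Triples containing a central `xᵢ` vanish, so only those in `x₁` and the `y`'s have to be
checked. -/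
theorem StandardBasis.hasP_of_center {b : S.StandardBasis 5} {α β : F}
    (hx : ∀ i : Fin 4, b.x i.succ ∈ S.center) (h00 : S.mul (b.x 0) (b.y 0) = 0)
    (hX : ∀ i j : Fin 4, i < j →
      S.form (S.mul (b.x 0) (b.y i.succ)) (b.y j.succ) = coeffX α β 0 i.succ j.succ)
    (hY : ∀ i j : Fin 4, i < j →
      S.form (S.mul (b.y 0) (b.y i.succ)) (b.y j.succ) = coeffY F 0 i.succ j.succ)
    (h0 : ∀ i j k : Fin 4, i < j → j < k →
      S.form (S.mul (b.y i.succ) (b.y j.succ)) (b.y k.succ) = 0) : b.HasP α β := by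
  have hmul : ∀ i j, S.mul (b.x i) (b.x j) = 0 := by
    intro i j
    obtain rfl | ⟨i, rfl⟩ := i.eq_zero_or_eq_succ
    · obtain rfl | ⟨j, rfl⟩ := j.eq_zero_or_eq_succ
      · exact S.mul_alt _
      · exact mul_right_of_mem_center (hx j) _
    · exact mem_center.1 (hx i) _
  refine ⟨fun i j k => by simp [hmul], fun i j k => by simp [hmul], ?_, ?_, ?_⟩
  · intro i j k hij hjk
    obtain ⟨j, rfl⟩ := Fin.exists_succ_eq.2 (Fin.ne_zero_of_lt hij)
    obtain ⟨k, rfl⟩ := Fin.exists_succ_eq.2 (Fin.ne_zero_of_lt hjk)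
    revert hij
    refine Fin.cases (fun _ => ?_) (fun i _ => ?_) i
    · exact hX j k (Fin.succ_lt_succ_iff.1 hjk)
    · rw [mem_center.1 (hx i), coeffX_succ]
      simp
  · intro i j k
    refine Fin.cases (fun hj => ?_) (fun i _ => ?_) i
    · rw [Fin.le_zero_iff.1 hj, h00]
      simp
    · rw [mem_center.1 (hx i)]
      simp
  · intro i j k hij hjk
    obtain ⟨j, rfl⟩ := Fin.exists_succ_eq.2 (Fin.ne_zero_of_lt hij)
    obtain ⟨k, rfl⟩ := Fin.exists_succ_eq.2 (Fin.ne_zero_of_lt hjk)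
    revert hij
    refine Fin.cases (fun _ => ?_) (fun i hij => ?_) i
    · exact hY j k (Fin.succ_lt_succ_iff.1 hjk)
    · rw [coeffY_succ]
      exact h0 i j k (Fin.succ_lt_succ_iff.1 hij) (Fin.succ_lt_succ_iff.1 hjk)

/-- The triple products of a frame vanish after translations by multiples of a vector whose form
is hyperbolic on the frame. -/
theorem exists_translate_form_mul_eq_zero (S : SAA F L) {z : L} {y : Fin 4 → L}
    (hy : ∀ i j, i < j → S.form (S.mul z (y i)) (y j) = coeffY F 0 i.succ j.succ) :
    ∃ p : Fin 4 → F, ∀ i j k, i < j → j < k →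
      S.form (S.mul (y i + p i • z) (y j + p j • z)) (y k + p k • z) = 0 := by
  have h01 := hy 0 1 (by decide)
  have h02 := hy 0 2 (by decide)
  have h03 := hy 0 3 (by decide)
  have h12 := hy 1 2 (by decide)
  have h13 := hy 1 3 (by decide)
  have h23 := hy 2 3 (by decide)
  simp only [coeffY, Fin.reduceSucc, Fin.succ_zero_eq_one, Fin.succ_one_eq_two] at *
  -- As `φ_z̄` pairs only `y 0` with `y 3` and `y 1` with `y 2`, each of the four triples involves a
  -- single unknown `p i`, with coefficient `±1`.
  refine ⟨![-S.form (S.mul (y 0) (y 1)) (y 2), S.form (S.mul (y 0) (y 1)) (y 3),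
    S.form (S.mul (y 0) (y 2)) (y 3), -S.form (S.mul (y 1) (y 2)) (y 3)],
    fun i j k hij hjk => ?_⟩
  rw [form_mul_add_smul]
  fin_cases i <;> fin_cases j <;> first | (exfalso; revert hij; decide) | skip
  all_goals fin_cases k <;> first | (exfalso; revert hjk; decide) | skip
  all_goals simp [h01, h02, h03, h12, h13, h23]

/-- Prescribing `x₁, y₁` modulo the centre is what lets this serve both the existence of a
presentation and the realisation of every change of parameters. -/
theorem IsTypeC.exists_hasP (h : S.IsTypeC) {z₁ z₂ : L} (hz₁ : z₁ ∈ S.power 2)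
    (hz₂ : z₂ ∈ S.power 2) (hz : S.form z₁ z₂ = 1) :
    ∃ (α β : F) (b : S.StandardBasis 5), b.HasP α β ∧ b.x 0 - z₁ ∈ S.center ∧
      b.y 0 - z₂ ∈ S.center := by
  have hab : ∀ {z w}, z ∈ S.power 2 → w ∈ S.power 2 → S.mul z w = 0 := fun hz hw =>
    S.mul_eq_zero_of_mem_power_two h.power_three_eq hz hw
  obtain ⟨α, β, y, hy⟩ := h.exists_frame hz₁ hz₂ hz
  obtain ⟨p, hp⟩ := S.exists_translate_form_mul_eq_zero fun i j hij => (hy i j hij).2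
  have hyp : ∀ z ∈ S.power 2, ∀ i j, S.form (S.mul z (y i + p i • z₂)) (y j + p j • z₂) =
      S.form (S.mul z (y i)) (y j) := fun z hzm i j => by
    have h1 : S.form (S.mul z (y i)) z₂ = 0 := by
      rw [S.form_mul_swap_right, hab hzm hz₂]; simp
    simp [hab hzm hz₂, h1]
  -- The pairings are values of the hyperbolic form `φ_z̄₂`; the order and signs of the products
  -- make them dual to the frame.
  have hxy : ∀ i j, S.form (![-S.mul z₂ (y 3), -S.mul z₂ (y 2), S.mul z₂ (y 1),
      S.mul z₂ (y 0)] i) (y j + p j • z₂) = if i = j then 1 else 0 := by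
    have hs : ∀ i j, S.form (S.mul z₂ (y i)) (y j + p j • z₂) = S.form (S.mul z₂ (y i)) (y j) :=
      fun i j => by simp [form_mul_self_outer]
    have h01 := (hy 0 1 (by decide)).2
    have h02 := (hy 0 2 (by decide)).2
    have h03 := (hy 0 3 (by decide)).2
    have h12 := (hy 1 2 (by decide)).2
    have h13 := (hy 1 3 (by decide)).2
    have h23 := (hy 2 3 (by decide)).2
    have h10 := S.form_mul_swap_right z₂ (y 1) (y 0)
    have h20 := S.form_mul_swap_right z₂ (y 2) (y 0)
    have h30 := S.form_mul_swap_right z₂ (y 3) (y 0)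
    have h21 := S.form_mul_swap_right z₂ (y 2) (y 1)
    have h31 := S.form_mul_swap_right z₂ (y 3) (y 1)
    have h32 := S.form_mul_swap_right z₂ (y 3) (y 2)
    simp only [coeffY, Fin.reduceSucc, Fin.succ_zero_eq_one, Fin.succ_one_eq_two] at *
    intro i j
    fin_cases i <;> fin_cases j <;>
      simp [hs, -map_add, form_mul_self_right, h01, h02, h03, h12, h13, h23, h10, h20, h30, h21,
        h31, h32]
  obtain ⟨b, hb1, hb2, hbx, hby⟩ := h.exists_standardBasis hz₁ hz₂ hz
    (fun i => by
      fin_cases i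
      · exact neg_mem (h.mul_mem_center hz₂ _)
      · exact neg_mem (h.mul_mem_center hz₂ _)
      · exact h.mul_mem_center hz₂ _
      · exact h.mul_mem_center hz₂ _) hxy
  refine ⟨α, β, b, StandardBasis.hasP_of_center hbx ?_ ?_ ?_ ?_, hb1, hb2⟩
  · refine S.eq_of_form_eq fun w => ?_
    rw [form_mul_congr hb1 hb2 (w' := w) (by simp), hab hz₁ hz₂]
  · intro i j hij
    rw [form_mul_congr hb1 (hby i) (hby j), hyp z₁ hz₁, (hy i j hij).1]
  · intro i j hij
    rw [form_mul_congr hb2 (hby i) (hby j), hyp z₂ hz₂, (hy i j hij).2]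
  · intro i j k hij hjk
    rw [form_mul_congr (hby i) (hby j) (hby k), hp i j k hij hjk]

theorem StandardBasis.HasP.no_root {b : S.StandardBasis 5} {α β : F} (hb : b.HasP α β)
    (h : S.IsTypeC) (t : F) : t ^ 2 + α * t + β ≠ 0 := by
  intro ht
  have hz : b.x 0 + t • b.y 0 ∈ S.power 2 :=
    add_mem hb.x_zero_mem (Submodule.smul_mem _ _ hb.y_zero_mem)
  have hzc : b.x 0 + t • b.y 0 ∉ S.center := fun hc => by
    simpa [StandardBasis.repr_x, StandardBasis.repr_y] using (hb.repr_of_mem_center hc).1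
  -- At a root `t` this vector spans part of the radical of `φ_z̄` for `z = x₁ + t y₁`.
  have hu : (α + t) • b.y 1 + b.y 3 ∉ S.power 2 := fun hu => by
    simpa [StandardBasis.repr_y] using hb.repr_inr_succ hu 2
  obtain ⟨v, hv⟩ := h.exists_form_mul_eq_one hz hzc hu
  rw [hb.form_mul_of_mem hz] at hv
  simp [minor, StandardBasis.repr_x, StandardBasis.repr_y] at hv
  apply one_ne_zero (α := F)
  rw [← hv]
  linear_combination (b.basis.repr v (.inr 4)) * ht

theorem IsTypeC.of_hasP {α β : F}
    (hαβ : Irreducible (Polynomial.X ^ 2 + Polynomial.C α * Polynomial.X + Polynomial.C β))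
    (h : S.HasP α β) : S.IsTypeC := by
  obtain ⟨b, hb⟩ := h
  exact hb.isTypeC ((irreducible_quadratic_iff α β).1 hαβ)

theorem IsTypeC.exists_irreducible (h : S.IsTypeC) :
    ∃ α β : F,
      Irreducible (Polynomial.X ^ 2 + Polynomial.C α * Polynomial.X + Polynomial.C β) ∧
        S.HasP α β := by
  obtain ⟨z₁, hz₁, z₂, hz₂, hz⟩ := h.exists_form_eq_one
  obtain ⟨α, β, b, hb, -⟩ := h.exists_hasP hz₁ hz₂ hz
  exact ⟨α, β, (irreducible_quadratic_iff α β).2 (hb.no_root h), b, hb⟩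

/-- The matrix sends `x₁, y₁` to another pair with form value 1, from which a presentation is built;
`HasP.parameters_eq` forces its parameters. -/
theorem StandardBasis.HasP.exists_hasP_of_det {b : S.StandardBasis 5} {α β : F}
    (hb : b.HasP α β) (h : S.IsTypeC) {a₁ a₂ a₃ a₄ : F} (hdet : a₁ * a₄ - a₂ * a₃ = 1) :
    S.HasP (((a₁ * a₄ + a₂ * a₃) * α + 2 * a₁ * a₃ * β + 2 * a₂ * a₄) /
        (a₄ ^ 2 + α * a₃ * a₄ + a₃ ^ 2 * β))
      ((a₂ ^ 2 + a₁ * a₂ * α + a₁ ^ 2 * β) / (a₄ ^ 2 + a₃ * a₄ * α + a₃ ^ 2 * β)) := by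
  have hmem : ∀ r s : F, r • b.x 0 + s • b.y 0 ∈ S.power 2 := fun r s =>
    add_mem (Submodule.smul_mem _ _ hb.x_zero_mem) (Submodule.smul_mem _ _ hb.y_zero_mem)
  have hform : S.form (a₁ • b.x 0 + a₂ • b.y 0) (a₃ • b.x 0 + a₄ • b.y 0) = 1 := by
    have hxy : S.form (b.x 0) (b.y 0) = 1 := b.form_x_y 0 0
    simp only [map_add, map_smul, LinearMap.add_apply, LinearMap.smul_apply, S.form_alt, hxy,
      S.form_skew (b.y 0) (b.x 0), smul_eq_mul]
    linear_combination hdet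
  obtain ⟨α', β', b', hb', h1, h2⟩ := h.exists_hasP (hmem a₁ a₂) (hmem a₃ a₄) hform
  have e1 := hb.repr_of_mem_center h1
  have e2 := hb.repr_of_mem_center h2
  simp only [map_sub, map_add, map_smul, repr_x, repr_y, Finsupp.sub_apply, Finsupp.add_apply,
    Finsupp.smul_apply, smul_eq_mul, sub_eq_zero] at e1 e2
  obtain ⟨-, hα, hβ⟩ := hb.parameters_eq hb' (a₁ := a₁) (a₂ := a₂) (a₃ := a₃) (a₄ := a₄)
    (by simpa using e1.1) (by simpa using e1.2 0) (by simpa using e2.1) (by simpa using e2.2 0)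
  rw [← hα, ← hβ]
  exact ⟨b', hb'⟩

end Construction
end SAA

theorem proposition2p6 {F : Type*} [Field F] :
    -- every algebra of type C has a presentation `P(α, β)` with `t² + α t + β` irreducible
    (∀ (L : Type*) [AddCommGroup L] [Module F L] (S : SAA F L), S.IsTypeC →
      ∃ α β : F,
        Irreducible (Polynomial.X ^ 2 + Polynomial.C α * Polynomial.X + Polynomial.C β) ∧
          S.HasP α β) ∧
    -- each such presentation is the presentation of some algebra
    (∀ α β : F,
      Irreducible (Polynomial.X ^ 2 + Polynomial.C α * Polynomial.X + Polynomial.C β) →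
        ∃ S : SAA F (Fin 5 ⊕ Fin 5 → F), S.HasP α β) ∧
    -- each algebra with such a presentation is of type C
    (∀ (L : Type*) [AddCommGroup L] [Module F L] (S : SAA F L) (α β : F),
      Irreducible (Polynomial.X ^ 2 + Polynomial.C α * Polynomial.X + Polynomial.C β) →
        S.HasP α β → S.IsTypeC) ∧
    -- two such presentations describe the same algebra iff the parameters are related
    (∀ (L L' : Type*) [AddCommGroup L] [Module F L] [AddCommGroup L'] [Module F L']
      (S : SAA F L) (S' : SAA F L') (α β α' β' : F),
      Irreducible (Polynomial.X ^ 2 + Polynomial.C α * Polynomial.X + Polynomial.C β) →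
      Irreducible (Polynomial.X ^ 2 + Polynomial.C α' * Polynomial.X + Polynomial.C β') →
      S.HasP α β → S'.HasP α' β' →
        (Nonempty (S.Iso S') ↔
          ∃ a b c d : F, a * d - b * c = 1 ∧
            α' = ((a * d + b * c) * α + 2 * a * c * β + 2 * b * d) /
              (d ^ 2 + α * c * d + c ^ 2 * β) ∧
            β' = (b ^ 2 + a * b * α + a ^ 2 * β) /
              (d ^ 2 + c * d * α + c ^ 2 * β))) := by
  refine ⟨fun L _ _ S h => h.exists_irreducible,
    fun α β _ => ⟨SAA.model α β, SAA.modelBasis α β, SAA.modelBasis_hasP α β⟩,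
    fun L _ _ S α β h hS => SAA.IsTypeC.of_hasP h hS,
    fun L L' _ _ _ _ S S' α β α' β' h _ hS hS' => ⟨?_, ?_⟩⟩
  · rintro ⟨e⟩
    obtain ⟨b, hb⟩ := hS'
    obtain ⟨b₀, hb₀⟩ := hS
    -- Transporting the first basis along `e` puts both presentations on `S'`.
    obtain ⟨hdet, hα, hβ⟩ := SAA.StandardBasis.HasP.parameters_eq
      (SAA.StandardBasis.HasPresentation.map hb₀ e) hb rfl rfl rfl rfl
    exact ⟨_, _, _, _, hdet, hα, hβ⟩
  · rintro ⟨a, b, c, d, hdet, rfl, rfl⟩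
    have hC := SAA.IsTypeC.of_hasP h hS
    obtain ⟨b₀, hb₀⟩ := hS
    -- `S` itself acquires the second presentation, and presentations determine the algebra.
    obtain ⟨b₁, hb₁⟩ := hb₀.exists_hasP_of_det hC hdet
    obtain ⟨b₂, hb₂⟩ := hS'
    exact ⟨SAA.StandardBasis.HasPresentation.iso hb₁ hb₂⟩
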